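/- **Setting.** Let $\mathcal M_G=\mathbb R^3\times\mathbb R$ be Newtonian spacetime and let $\widetilde G$ be the Bargmann group, i.e. the central extension by $\mathbb R$ of the Galilei group of transformations $(\mathbf x,t)\mapsto(R\mathbf x+t\mathbf v+\mathbf a,\,t+\tau)$, $R\in SO(3)$, with cocycle $\mathbf v_2\cdot R_2\mathbf a_1+\tfrac12|\mathbf v_2|^2\tau_1$. Consider a complex Hilbert space $\mathcal H$; von Neumann algebras $\mathcal F(\mathcal O)$ on $\mathcal H$ indexed by the bounded open $\mathcal O\subset\mathcal M_G$; a strongly continuous unitary representation $U$ of $\widetilde G$ on $\mathcal H$; a unit vector $\Omega\in\mathcal H$; and closed densely defined operators $\hat\psi(f)$, $f\in C_c^\infty(\mathcal M_G)$, with adjoints $\hat\psi^\dagger(f)=\hat\psi(f)^*$. Write $e^{i\tau\hat H}$ for the time translations and $U(\theta)=e^{i\theta\hat M}$ for the central subgroup. The axioms are: * **(G1)** $\mathcal O_1\subset\mathcal O_2$ implies $\mathcal F(\mathcal O_1)\subset\mathcal F(\mathcal O_2)$. * **(G2)** If for every $t$ the time-$t$ slices of $\mathcal O_1$ and $\mathcal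 O_2$ have disjoint closures, then $\mathcal F(\mathcal O_1)$ and $\mathcal F(\mathcal O_2)$ commute. * **(G3)** $U(g)\mathcal F(\mathcal O)U(g)^*=\mathcal F(g\mathcal O)$ for all $g\in\widetilde G$, and $\mathcal H$ is the Hilbert direct sum of the eigenspaces of $\hat M$. * **(G4)** $\mathcal F(\mathcal O)$ is generated by the fields $\hat\psi(f),\hat\psi^\dagger(f)$ with $\operatorname{supp} f\subseteq\mathcal O$ (it is the smallest von Neumann algebra to which they are affiliated). Moreover, whenever time-zero fields exist, i.e. whenever on a common dense domain $\mathcal D$ the strong limits $\hat\psi_0(g)=\lim_{\epsilon\to0^+}\hat\psi(\chi_\epsilon\otimes g)$ and $\hat\psi_0^\dagger(g)=\lim_{\epsilon\to0^+}\hat\psi^\dagger(\chi_\epsilon\otimes g)$, $g\in C_c^\infty(\mathbb R^3)$, exist, are the same for all approximating families $\chi_\epsilon\to\delta_0$ (smooth, nonnegative, of integral one, with supports shrinking to $\{0\}$), and $\mathcal D$ is stable under $\hat H$ and all time-zero fields, then on $\mathcal D$ $$[\hat\psi_0(g_1),\hat\psi_0^\dagger(g_2)]=\int_{\mathbb R^3}\overline{g_1}\,g_2\,d^3x\cdot\mathbb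 1,\qquad[\hat\psi_0(g_1),\hat\psi_0(g_2)]=0 .$$ * **(G5)** $\sigma(\hat H)\subset[0,\infty)$. * **(G6)** $\Omega$ is invariant under all space and time translations, and every unit vector with this property is a multiple of $\Omega$ by a phase. Consider further: * **(G7\*)(a)** There is $m_0>0$ with $U(\theta)\hat\psi(f)U(\theta)^{-1}=e^{-i\theta m_0}\hat\psi(f)$ and $U(\theta)\hat\psi^\dagger(f)U(\theta)^{-1}=e^{i\theta m_0}\hat\psi^\dagger(f)$ for all $\theta$ and $f$. * **(G7\*)(d)** Time-zero fields exist, in the sense of (G4), on a domain $\mathcal D$ that contains $\Omega$, and such that every finite product of fields $\hat\psi(\chi_\epsilon\otimes g_j)$, $\hat\psi^\dagger(\chi_\epsilon\otimes g_j)$ applied to a vector of $\mathcal D$ is defined for small $\epsilon$ and converges to the corresponding product of time-zero fields applied to that vector. * **Reeh–Schlieder property.** For every bounded open $\mathcal O$ such that $\mathcal O$ and its complement have non-empty interior, $\Omega$ is cyclic and separating for $\mathcal F(\mathcal O)$. **Theorem.** If (G1)–(G6), (G7\*)(a) and (G7\*)(d) hold, then the Reeh–Schlieder property fails. The same conclusion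 holds without assuming (G2). -/

import Mathlib

open Filter Topology MeasureTheory
open scoped ContDiff Distributions ComplexConjugate

noncomputable section

namespace Galilean

/-! ### Newtonian spacetime and test functions -/

/-- Euclidean space `ℝ³`. -/
abbrev Space : Type := EuclideanSpace ℝ (Fin 3)

/-- Newtonian spacetime `ℝ³ × ℝ`; a point is `(x, t)`. -/
abbrev Spacetime : Type := Space × ℝ

/-- `C_c^∞(ℝ³)`, complex valued. -/
abbrev SpaceTest : Type := 𝓓((⊤ : TopologicalSpace.Opens Space), ℂ)

/-- `C_c^∞(ℝ³ × ℝ)`, complex valued. -/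
abbrev SpacetimeTest : Type := 𝓓((⊤ : TopologicalSpace.Opens Spacetime), ℂ)

/-- `C_c^∞(ℝ)`, real valued. -/
abbrev TimeTest : Type := 𝓓((⊤ : TopologicalSpace.Opens ℝ), ℝ)

/-- The test function `(χ ⊗ g)(x, t) = χ(t) g(x)`. -/
def tensor (χ : TimeTest) (g : SpaceTest) : SpacetimeTest where
  toFun p := (χ p.2 : ℂ) * g p.1
  contDiff' := by
    have h1 : ContDiff ℝ ∞ (fun p : Spacetime => ((χ p.2 : ℝ) : ℂ)) :=
      Complex.ofRealCLM.contDiff.comp (χ.contDiff.comp contDiff_snd)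
    have h2 : ContDiff ℝ ∞ (fun p : Spacetime => g p.1) := g.contDiff.comp contDiff_fst
    exact h1.mul h2
  hasCompactSupport' := by
    refine HasCompactSupport.intro (K := tsupport g ×ˢ tsupport χ)
      (g.hasCompactSupport.isCompact.prod χ.hasCompactSupport.isCompact) ?_
    intro p hp
    by_cases h : p.1 ∈ tsupport g
    · have h' : p.2 ∉ tsupport χ := fun h' => hp ⟨h, h'⟩
      simp [image_eq_zero_of_notMem_tsupport h']
    · simp [image_eq_zero_of_notMem_tsupport h]
  tsupport_subset' := fun _ _ => trivial

/-- An approximating family `χ_ε → δ₀` as `ε → 0⁺`: nonnegative smooth functions of integral one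
whose supports shrink to `{0}`. -/
structure DeltaFamily where
  fn : ℝ → TimeTest
  nonneg : ∀ ε, 0 < ε → ∀ t, 0 ≤ fn ε t
  integral_eq_one : ∀ ε, 0 < ε → ∫ t, fn ε t = 1
  support_shrinks : ∀ V ∈ 𝓝 (0 : ℝ), ∀ᶠ ε in 𝓝[>] (0 : ℝ), tsupport (fn ε) ⊆ V

/-- The regions of the net: bounded open subsets of spacetime. -/
def IsRegion (O : Set Spacetime) : Prop := IsOpen O ∧ Bornology.IsBounded O

/-- The time-`t` slice of a set, as a subset of `ℝ³`. -/
def slice (O : Set Spacetime) (t : ℝ) : Set Space := {x | (x, t) ∈ O}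

/-! ### The Bargmann group and its action on spacetime -/

/-- The rotation group `SO(3)`. -/
abbrev SO3 : Type := Matrix.specialOrthogonalGroup (Fin 3) ℝ

/-- The action of a rotation on `ℝ³`. -/
def rotate (R : SO3) : Space →L[ℝ] Space :=
  Matrix.toEuclideanCLM (n := Fin 3) (𝕜 := ℝ) (R : Matrix (Fin 3) (Fin 3) ℝ)

theorem rotate_one (x : Space) : rotate 1 x = x := by
  simp [rotate]

theorem rotate_mul (R S : SO3) (x : Space) : rotate (R * S) x = rotate R (rotate S x) := by
  simp [rotate]

theorem inner_rotate (R : SO3) (x y : Space) :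
    inner ℝ (rotate R x) (rotate R y) = inner ℝ x y := by
  have h : star (R : Matrix (Fin 3) (Fin 3) ℝ) * (R : Matrix (Fin 3) (Fin 3) ℝ) = 1 :=
    (Matrix.mem_unitaryGroup_iff'.1 (Matrix.mem_specialOrthogonalGroup_iff.1 R.2).1)
  have h2 : star (rotate R) * rotate R = 1 := by
    unfold rotate
    rw [← map_star, ← map_mul, h, map_one]
  rw [← ContinuousLinearMap.adjoint_inner_right, ← ContinuousLinearMap.star_eq_adjoint,
    ← mul_apply_eq_comp, h2]
  simp

/-- The Bargmann group: the central extension by `ℝ` of the Galilei group. The element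
`(R, v, a, τ, θ)` lies over the Galilei transformation `(x, t) ↦ (R x + t v + a, t + τ)`. -/
@[ext]
structure BargmannGroup where
  rot : SO3
  boost : Space
  trans : Space
  time : ℝ
  phase : ℝ

namespace BargmannGroup

/-- Composition of Galilei transformations; the central parts are added together with the
Bargmann cocycle `v₂ · R₂ a₁ + |v₂|² τ₁ / 2`. -/
instance : Mul BargmannGroup where
  mul g h :=
    { rot := g.rot * h.rot
      boost := rotate g.rot h.boost + g.boost
      trans := rotate g.rot h.trans + h.time • g.boost + g.trans
      time := g.time + h.time
      phase := g.phase + h.phase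
        + (inner ℝ g.boost (rotate g.rot h.trans) + inner ℝ g.boost g.boost / 2 * h.time) }

instance : One BargmannGroup where
  one := ⟨1, 0, 0, 0, 0⟩

instance : Inv BargmannGroup where
  inv g :=
    { rot := g.rot⁻¹
      boost := -rotate g.rot⁻¹ g.boost
      trans := -rotate g.rot⁻¹ (g.trans - g.time • g.boost)
      time := -g.time
      phase := -g.phase + inner ℝ g.boost g.trans - inner ℝ g.boost g.boost / 2 * g.time }

theorem mul_def (g h : BargmannGroup) : g * h =
    { rot := g.rot * h.rot
      boost := rotate g.rot h.boost + g.boost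
      trans := rotate g.rot h.trans + h.time • g.boost + g.trans
      time := g.time + h.time
      phase := g.phase + h.phase
        + (inner ℝ g.boost (rotate g.rot h.trans)
          + inner ℝ g.boost g.boost / 2 * h.time) } := rfl

theorem one_def : (1 : BargmannGroup) = ⟨1, 0, 0, 0, 0⟩ := rfl

theorem inv_def (g : BargmannGroup) : g⁻¹ =
    { rot := g.rot⁻¹
      boost := -rotate g.rot⁻¹ g.boost
      trans := -rotate g.rot⁻¹ (g.trans - g.time • g.boost)
      time := -g.time
      phase := -g.phase + inner ℝ g.boost g.trans
        - inner ℝ g.boost g.boost / 2 * g.time } := rfl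

instance : Group BargmannGroup := by
  refine Group.ofLeftAxioms ?_ ?_ ?_
  · intro g h k
    simp only [mul_def]
    ext1
    · simp only [mul_assoc]
    · simp only [rotate_mul, map_add]; abel
    · simp only [rotate_mul, map_add, map_smul]; module
    · simp only [add_assoc]
    · simp only [rotate_mul, map_add, map_smul, inner_add_left, inner_add_right,
        inner_smul_right, inner_rotate]
      rw [real_inner_comm g.boost (rotate g.rot h.boost)]
      ring
  · intro g
    simp only [mul_def, one_def]
    ext1 <;> simp [rotate_one]
  · intro g
    simp only [mul_def, one_def, inv_def]
    ext1
    · simp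
    · simp
    · simp only [map_sub, map_smul]; module
    · simp
    · simp only [inner_neg_left, inner_neg_right, neg_neg, inner_rotate]
      ring

/-- The topology of `SO(3) × ℝ³ × ℝ³ × ℝ × ℝ`. -/
instance : TopologicalSpace BargmannGroup :=
  TopologicalSpace.induced (fun g => (g.rot, g.boost, g.trans, g.time, g.phase)) inferInstance

/-- The geometric action on spacetime; the centre acts trivially. -/
instance : MulAction BargmannGroup Spacetime where
  smul g p := (rotate g.rot p.1 + p.2 • g.boost + g.trans, p.2 + g.time)
  one_smul p := by
    change (rotate 1 p.1 + p.2 • (0 : Space) + 0, p.2 + 0) = p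
    simp [rotate_one]
  mul_smul g h p := by
    change (rotate (g.rot * h.rot) p.1 + p.2 • (rotate g.rot h.boost + g.boost)
        + (rotate g.rot h.trans + h.time • g.boost + g.trans), p.2 + (g.time + h.time))
      = (rotate g.rot (rotate h.rot p.1 + p.2 • h.boost + h.trans)
        + (p.2 + h.time) • g.boost + g.trans, p.2 + h.time + g.time)
    refine Prod.ext ?_ ?_
    · simp only [rotate_mul, map_add, map_smul]; module
    · simp only; ring

/-- The translation by `a` in space and by `τ` in time. -/
def translation (a : Space) (τ : ℝ) : BargmannGroup := ⟨1, 0, a, τ, 0⟩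

/-- The central one-parameter subgroup. -/
def central (θ : ℝ) : BargmannGroup := ⟨1, 0, 0, 0, θ⟩

end BargmannGroup

/-! ### Unbounded operators -/

section Operators

variable {H : Type*} [NormedAddCommGroup H] [InnerProductSpace ℂ H]

/-- The generator `A` of a one-parameter family `u(t) = exp(i t A)`: `A x = -i (d/dt) u(t) x` at
`t = 0`, on all vectors for which the derivative exists in norm. -/
def generator (u : ℝ → H →L[ℂ] H) : H →ₗ.[ℂ] H where
  domain :=
    { carrier := {x | DifferentiableAt ℝ (fun t => u t x) 0}
      add_mem' := by
        intro x y hx hy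
        simpa only [Set.mem_ofPred_eq, map_add] using DifferentiableAt.fun_add hx hy
      zero_mem' := by simp
      smul_mem' := by
        intro c x hx
        simpa only [Set.mem_ofPred_eq, map_smul] using DifferentiableAt.fun_const_smul hx c }
  toFun :=
    { toFun := fun x => (-Complex.I) • deriv (fun t => u t (x : H)) 0
      map_add' := by
        intro x y
        have hx : DifferentiableAt ℝ (fun t => u t (x : H)) 0 := x.2
        have hy : DifferentiableAt ℝ (fun t => u t (y : H)) 0 := y.2
        simp only [Submodule.coe_add, map_add]
        rw [deriv_fun_add hx hy, smul_add]
      map_smul' := by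
        intro c x
        have hx : DifferentiableAt ℝ (fun t => u t (x : H)) 0 := x.2
        simp only [Submodule.coe_smul, map_smul, RingHom.id_apply]
        rw [deriv_fun_const_smul c hx, smul_comm] }

/-- The spectrum of an unbounded operator: the `z` for which `A - z` is not a bijection from the
domain of `A` onto `H` with bounded inverse. -/
def unboundedSpectrum (A : H →ₗ.[ℂ] H) : Set ℂ :=
  {z | ¬ ∃ R : H →L[ℂ] H,
    (∀ y : H, ∃ h : R y ∈ A.domain, A ⟨R y, h⟩ - z • R y = y) ∧
    (∀ x : A.domain, R (A x - z • (x : H)) = x)}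

/-- The eigenspace `{x ∈ dom A | A x = c x}`. -/
def eigenspace (A : H →ₗ.[ℂ] H) (c : ℂ) : Submodule ℂ H where
  carrier := {x | (x, c • x) ∈ A.graph}
  add_mem' := by
    intro x y hx hy
    have := A.graph.add_mem hx hy
    simpa only [Set.mem_ofPred_eq, Prod.mk_add_mk, smul_add] using this
  zero_mem' := by
    have := A.graph.zero_mem
    simp only [Set.mem_ofPred_eq, smul_zero]
    exact this
  smul_mem' := by
    intro d x hx
    have := A.graph.smul_mem d hx
    simpa only [Set.mem_ofPred_eq, Prod.smul_mk, smul_comm d c x] using this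

/-- `ComposesTo [A₁, …, Aₙ] x y` says that `x` lies in the natural domain of the product
`A₁ ⋯ Aₙ` and `A₁ ⋯ Aₙ x = y`. -/
def ComposesTo : List (H →ₗ.[ℂ] H) → H → H → Prop
  | [], x, y => y = x
  | A :: L, x, y => ∃ z, ComposesTo L x z ∧ (z, y) ∈ A.graph

variable [CompleteSpace H]

/-- The operator `u A u⁻¹`, with domain `u (dom A)`. -/
def conjugate (u : unitary (H →L[ℂ] H)) (A : H →ₗ.[ℂ] H) : H →ₗ.[ℂ] H where
  domain := A.domain.comap (star (u : H →L[ℂ] H)).toLinearMap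
  toFun :=
    { toFun := fun x => (u : H →L[ℂ] H) (A ⟨star (u : H →L[ℂ] H) x, x.2⟩)
      map_add' := by
        intro x y
        rw [← map_add, ← LinearPMap.map_add]
        congr 2
        exact Subtype.ext (by simp)
      map_smul' := by
        intro c x
        rw [RingHom.id_apply, ← map_smul, ← LinearPMap.map_smul]
        congr 2
        exact Subtype.ext (by simp) }

/-- The closed densely defined operator `A` is affiliated to the von Neumann algebra `M`: it
commutes with every bounded operator in the commutant of `M`. -/
def IsAffiliated (A : H →ₗ.[ℂ] H) (M : VonNeumannAlgebra H) : Prop :=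
  Dense (A.domain : Set H) ∧ A.IsClosed ∧
    ∀ T ∈ M.commutant, ∀ x y : H, (x, y) ∈ A.graph → (T x, T y) ∈ A.graph

end Operators

/-! ### Galilean nets -/

/-- The two kinds of canonical fields, `ψ` and `ψ†`. -/
inductive FieldKind
  | psi
  | psiDag

/-- The data of a Galilean net with canonical fields on the Hilbert space `H`. The algebras are
used only on bounded open sets. -/
structure GalileanNet (H : Type*) [NormedAddCommGroup H] [InnerProductSpace ℂ H]
    [CompleteSpace H] where
  /-- The local field algebras `𝓕(O)`. -/
  algebra : Set Spacetime → VonNeumannAlgebra H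
  /-- The unitary representation of the Bargmann group. -/
  U : BargmannGroup →* unitary (H →L[ℂ] H)
  /-- Strong continuity. -/
  continuous_U : ∀ x : H, Continuous fun g => (U g : H →L[ℂ] H) x
  /-- The vacuum. -/
  vacuum : H
  norm_vacuum : ‖vacuum‖ = 1
  /-- The smeared canonical field `ψ(f)`, a closed densely defined operator. -/
  psi : SpacetimeTest → H →ₗ.[ℂ] H
  dense_psi : ∀ f, Dense ((psi f).domain : Set H)
  closed_psi : ∀ f, (psi f).IsClosed

namespace GalileanNet

variable {H : Type*} [NormedAddCommGroup H] [InnerProductSpace ℂ H] [CompleteSpace H]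
variable (N : GalileanNet H)

/-- The smeared canonical fields `ψ(f)` and `ψ†(f) = ψ(f)*`. -/
def field : FieldKind → SpacetimeTest → H →ₗ.[ℂ] H
  | .psi, f => N.psi f
  | .psiDag, f => (N.psi f).adjoint

/-- The Hamiltonian: `U(0, τ) = exp(i τ Ĥ)`. -/
def hamiltonian : H →ₗ.[ℂ] H :=
  generator fun τ => (N.U (BargmannGroup.translation 0 τ) : H →L[ℂ] H)

/-- The mass operator, the generator of the central subgroup: `U(θ) = exp(i θ M̂)`. It is
self-adjoint and commutes with the representation because `U` is unitary, strongly continuous and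
the subgroup is central. -/
def massOperator : H →ₗ.[ℂ] H :=
  generator fun θ => (N.U (BargmannGroup.central θ) : H →L[ℂ] H)

/-- The eigenspace of the mass operator at `M`. -/
def massSector (M : ℝ) : Submodule ℂ H := eigenspace N.massOperator (M : ℂ)

/-- (G1) Isotony. -/
def Isotony : Prop :=
  ∀ O₁ O₂, IsRegion O₁ → IsRegion O₂ → O₁ ⊆ O₂ → N.algebra O₁ ≤ N.algebra O₂

/-- (G2) Equal-time locality: the algebras of two regions commute if at every time the slices of
the regions have disjoint closures. -/
def EqualTimeLocality : Prop :=
  ∀ O₁ O₂, IsRegion O₁ → IsRegion O₂ →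
    (∀ t, Disjoint (closure (slice O₁ t)) (closure (slice O₂ t))) →
    ∀ A ∈ N.algebra O₁, ∀ B ∈ N.algebra O₂, A * B = B * A

/-- (G3) Galilean covariance with Bargmann extension: `U(g) 𝓕(O) U(g)* = 𝓕(g O)`, and `H` is the
Hilbert direct sum of the mass eigenspaces. -/
def Covariance : Prop :=
  (∀ g O, IsRegion O →
    (fun A : H →L[ℂ] H => (N.U g : H →L[ℂ] H) * A * star (N.U g : H →L[ℂ] H)) ''
        (N.algebra O : Set (H →L[ℂ] H))
      = (N.algebra ((fun p => g • p) '' O) : Set (H →L[ℂ] H))) ∧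
  IsHilbertSum ℂ (fun M : ℝ => N.massSector M) (fun M : ℝ => (N.massSector M).subtypeₗᵢ)

/-- Time-zero fields: limits `ψ₀(g) = lim ψ(χ_ε ⊗ g)` and `ψ₀†(g) = lim ψ†(χ_ε ⊗ g)`, strong on a
common dense domain that is stable under the Hamiltonian and under the time-zero fields, and
independent of the approximating family `χ_ε → δ₀`. -/
structure TimeZeroFields where
  domain : Submodule ℂ H
  dense_domain : Dense (domain : Set H)
  hamiltonian_stable : ∀ x ∈ domain, ∃ y ∈ domain, (x, y) ∈ N.hamiltonian.graph
  field₀ : FieldKind → SpaceTest → Module.End ℂ domain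
  tendsto_field₀ : ∀ (k : FieldKind) (g : SpaceTest) (χ : DeltaFamily) (x : domain),
    ∃ z : ℝ → H,
      (∀ᶠ ε in 𝓝[>] (0 : ℝ), ((x : H), z ε) ∈ (N.field k (tensor (χ.fn ε) g)).graph) ∧
      Tendsto z (𝓝[>] 0) (𝓝 (field₀ k g x : H))

/-- (G4), generation: on every region, `𝓕(O)` is the smallest von Neumann algebra to which all
fields `ψ(f)`, `ψ†(f)` with `supp f ⊆ O` are affiliated. -/
def GeneratedByFields : Prop :=
  ∀ O, IsRegion O →
    IsLeast {M : VonNeumannAlgebra H |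
      ∀ (k : FieldKind) (f : SpacetimeTest), tsupport f ⊆ O → IsAffiliated (N.field k f) M}
      (N.algebra O)

/-- (G4), equal-time canonical commutation relations: whenever time-zero fields exist,
`[ψ₀(g₁), ψ₀†(g₂)] = ⟨g₁, g₂⟩ · 1` and `[ψ₀(g₁), ψ₀(g₂)] = 0` on their domain. -/
def EqualTimeCCR : Prop :=
  ∀ (T : N.TimeZeroFields) (g₁ g₂ : SpaceTest),
    T.field₀ .psi g₁ * T.field₀ .psiDag g₂ - T.field₀ .psiDag g₂ * T.field₀ .psi g₁
      = (∫ x, conj (g₁ x) * g₂ x) • (1 : Module.End ℂ T.domain) ∧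
    T.field₀ .psi g₁ * T.field₀ .psi g₂ - T.field₀ .psi g₂ * T.field₀ .psi g₁ = 0

/-- (G5) Positive energy: `σ(Ĥ) ⊆ [0, ∞)`. -/
def PositiveEnergy : Prop :=
  unboundedSpectrum N.hamiltonian ⊆ (fun r : ℝ => (r : ℂ)) '' Set.Ici 0

/-- Invariance of a vector under all spatial and time translations. -/
def IsTranslationInvariant (x : H) : Prop :=
  ∀ (a : Space) (τ : ℝ), (N.U (BargmannGroup.translation a τ) : H →L[ℂ] H) x = x

/-- (G6) The vacuum is translation invariant, and it is the only translation invariant unit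
vector up to a phase. -/
def UniqueVacuum : Prop :=
  N.IsTranslationInvariant N.vacuum ∧
  ∀ x : H, ‖x‖ = 1 → N.IsTranslationInvariant x → ∃ c : ℂ, ‖c‖ = 1 ∧ x = c • N.vacuum

/-- The axioms (G1), (G3), (G4), (G5), (G6). -/
structure AxiomsExceptLocality : Prop where
  isotony : N.Isotony
  covariance : N.Covariance
  generated : N.GeneratedByFields
  ccr : N.EqualTimeCCR
  positive_energy : N.PositiveEnergy
  unique_vacuum : N.UniqueVacuum

/-- A Galilean Haag–Kastler net: the axioms (G1)–(G6). -/
structure IsHaagKastler : Prop extends N.AxiomsExceptLocality where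
  locality : N.EqualTimeLocality

/-- The canonical fields carry mass charge `∓ m₀`: `U(θ) ψ(f) U(θ)⁻¹ = exp(-i θ m₀) ψ(f)` and
`U(θ) ψ†(f) U(θ)⁻¹ = exp(i θ m₀) ψ†(f)`. -/
def HasMassCharge (m₀ : ℝ) : Prop :=
  ∀ (θ : ℝ) (f : SpacetimeTest),
    conjugate (N.U (BargmannGroup.central θ)) (N.field .psi f)
      = Complex.exp (-(Complex.I * θ * m₀)) • N.field .psi f ∧
    conjugate (N.U (BargmannGroup.central θ)) (N.field .psiDag f)
      = Complex.exp (Complex.I * θ * m₀) • N.field .psiDag f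

/-- Regularity of the time-zero limit: the domain contains the vacuum, and finite products of
smeared fields are defined on the domain and converge strongly there to the corresponding products
of time-zero fields. -/
def TimeZeroFields.IsRegular {N : GalileanNet H} (T : N.TimeZeroFields) : Prop :=
  N.vacuum ∈ T.domain ∧
  ∀ (w : List (FieldKind × SpaceTest)) (χ : DeltaFamily) (x : T.domain),
    ∃ z : ℝ → H,
      (∀ᶠ ε in 𝓝[>] (0 : ℝ),
        ComposesTo (w.map fun p => N.field p.1 (tensor (χ.fn ε) p.2)) (x : H) (z ε)) ∧
      Tendsto z (𝓝[>] 0) (𝓝 ((w.map fun p => T.field₀ p.1 p.2).prod x : H))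

/-- Time-zero fields exist on a field-stable common dense domain containing the vacuum. -/
def TimeZeroFieldsExist : Prop := ∃ T : N.TimeZeroFields, T.IsRegular

/-- The Reeh–Schlieder property: the vacuum is cyclic and separating for every `𝓕(O)`, where `O`
is bounded open and both `O` and its complement have non-empty interior. -/
def ReehSchlieder : Prop :=
  ∀ O, IsRegion O → (interior O).Nonempty → (interior Oᶜ).Nonempty →
    Dense {y : H | ∃ A ∈ N.algebra O, A N.vacuum = y} ∧
    ∀ A ∈ N.algebra O, A N.vacuum = 0 → A = 0

end GalileanNet

end Galilean

end

/-! Annihilation fields lower the mass, and positive energy leaves nothing below mass zero. The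
central unitaries commute with translations, so uniqueness makes the vacuum an eigenvector of each
of them. Boosts and translations commute only up to a central phase, which forces the eigenvalue to
be 1 (`central_vacuum`). Hence `ψ(f)Ω`, wherever defined, has mass `-m₀`.

On mass `M`, a boost by `s e` turns the energy expectation into `⟨H⟩ + s⟨P·e⟩ + s²|e|²M‖z‖²/2`. For
`M < 0` this is unbounded below, so negative mass is excluded (`eq_zero_of_hasMass_neg`) and `ψ(f)Ω
= 0`.

If Reeh–Schlieder held, `Ω` would be separating for a local algebra to which `ψ(f)` is affiliated.
The projection onto the kernel of `ψ(f)` lies in that algebra and fixes `Ω`, hence is 1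
(`IsAffiliated.apply_eq_zero`). The fields `ψ(f)` would then vanish, and with them their time-zero
limits, contradicting the canonical commutation relations. -/

namespace Galilean

/-! ### Strongly continuous families, resolvents and positivity of unbounded operators. -/

section Operators

variable {H : Type*} [NormedAddCommGroup H] [InnerProductSpace ℂ H]

/-- If `p` is differentiable at `0` and `u` is a strongly continuous family of contractions with
`u(t) p(0)` differentiable at `0`, then so is `u(t) p(t)`. -/
theorem hasDerivAt_apply_of_contraction {u : ℝ → H →L[ℂ] H} (hu : ∀ t x, ‖u t x‖ ≤ ‖x‖)
    (hc : ∀ x, Continuous fun t => u t x) {p : ℝ → H} {p' d : H} (hp : HasDerivAt p p' 0)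
    (hd : HasDerivAt (fun t => u t (p 0)) d 0) :
    HasDerivAt (fun t => u t (p t)) (d + u 0 p') 0 := by
  -- Split `u(t)p(t) = u(t)p(0) + u(t)(p(t) - p(0))`. The contraction bound controls the second
  -- difference quotient, so strong continuity suffices.
  have h2 : HasDerivAt (fun t => u t (p t - p 0)) (u 0 p') 0 := by
    rw [hasDerivAt_iff_tendsto_slope] at hp ⊢
    have e : slope (fun t => u t (p t - p 0)) 0 = fun t => u t (slope p 0 t) := by
      funext t
      simp only [slope_def_module, sub_zero, sub_self, map_zero]
      simp only [← Complex.coe_smul, map_smul]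
    rw [e]
    have h1 : Tendsto (fun t => u t (slope p 0 t - p')) (𝓝[≠] 0) (𝓝 0) := by
      refine squeeze_zero_norm (fun t => hu t _) ?_
      simpa using (hp.sub_const p').norm
    have h3 : Tendsto (fun t => u t p') (𝓝[≠] 0) (𝓝 (u 0 p')) :=
      ((hc p').tendsto 0).mono_left nhdsWithin_le_nhds
    simpa using h1.add h3
  have := hd.fun_add h2
  simpa using this

/-- `R` is the resolvent `(A + l)⁻¹`. -/
def IsResolventAt (A : H →ₗ.[ℂ] H) (l : ℝ) (R : H →L[ℂ] H) : Prop :=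
  (∀ y : H, ∃ h : R y ∈ A.domain, A ⟨R y, h⟩ + (l : ℂ) • R y = y) ∧
    ∀ x : A.domain, R (A x + (l : ℂ) • (x : H)) = x

theorem exists_isResolventAt {A : H →ₗ.[ℂ] H}
    (hA : unboundedSpectrum A ⊆ (fun r : ℝ => (r : ℂ)) '' Set.Ici 0) {l : ℝ} (hl : 0 < l) :
    ∃ R, IsResolventAt A l R := by
  have h : (-(l : ℂ)) ∉ unboundedSpectrum A := by
    intro h
    obtain ⟨r, hr, hr'⟩ := hA h
    have : r = -l := Complex.ofReal_injective (by simpa using hr')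
    rw [Set.mem_Ici] at hr
    linarith
  obtain ⟨R, h1, h2⟩ := not_not.1 h
  refine ⟨R, ?_, ?_⟩
  · simpa only [neg_smul, sub_neg_eq_add] using h1
  · simpa only [neg_smul, sub_neg_eq_add] using h2

namespace IsResolventAt

variable {A : H →ₗ.[ℂ] H} {l m : ℝ} {R S : H →L[ℂ] H}

/-- Apply `R` to `y = (A + l)Sy + (m - l)Sy`. -/
theorem resolvent_identity (hR : IsResolventAt A l R) (hS : IsResolventAt A m S) :
    R = S + ((m - l : ℝ) : ℂ) • (R * S) := by
  ext y
  obtain ⟨h, hy⟩ := hS.1 y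
  have h2 := hR.2 ⟨S y, h⟩
  have : y = (A ⟨S y, h⟩ + (l : ℂ) • S y) + ((m - l : ℝ) : ℂ) • S y := by
    conv_lhs => rw [← hy]
    push_cast
    module
  conv_lhs => rw [this]
  rw [map_add, h2]
  simp

theorem injective (hR : IsResolventAt A l R) {y : H} (hy : R y = 0) : y = 0 := by
  obtain ⟨h, e⟩ := hR.1 y
  have h0 : (⟨R y, h⟩ : A.domain) = 0 := Subtype.ext hy
  rw [h0, hy] at e
  simpa using e.symm

/-- The resolvent commutes with every bounded operator commuting with `A`. -/
theorem commute (hR : IsResolventAt A l R) {V : H →L[ℂ] H}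
    (hV : ∀ x : A.domain, ∃ h : V x ∈ A.domain, A ⟨V x, h⟩ = V (A x)) (y : H) :
    R (V y) = V (R y) := by
  obtain ⟨h, e⟩ := hR.1 y
  obtain ⟨h', e'⟩ := hV ⟨R y, h⟩
  have h2 := hR.2 ⟨V (R y), h'⟩
  rw [e'] at h2
  refine Eq.trans ?_ h2
  conv_lhs => rw [← e]
  simp

variable [CompleteSpace H]

theorem isSelfAdjoint (hR : IsResolventAt A l R)
    (hA : ∀ x y : A.domain, inner ℂ (A x) (y : H) = inner ℂ (x : H) (A y)) :
    IsSelfAdjoint R := by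
  rw [ContinuousLinearMap.isSelfAdjoint_iff_isSymmetric]
  intro x y
  obtain ⟨hx, ex⟩ := hR.1 x
  obtain ⟨hy, ey⟩ := hR.1 y
  have h := hA ⟨R x, hx⟩ ⟨R y, hy⟩
  change inner ℂ (R x) y = inner ℂ x (R y)
  conv_lhs => rw [← ey]
  conv_rhs => rw [← ex]
  rw [inner_add_left, inner_add_right, h, inner_smul_left, inner_smul_right, Complex.conj_ofReal]

end IsResolventAt

variable [CompleteSpace H] {A : H →ₗ.[ℂ] H}

/-- A symmetric operator with nonnegative spectrum is nonnegative. -/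
theorem re_inner_nonneg_of_unboundedSpectrum
    (hA : ∀ x y : A.domain, inner ℂ (A x) (y : H) = inner ℂ (x : H) (A y))
    (hσ : unboundedSpectrum A ⊆ (fun r : ℝ => (r : ℂ)) '' Set.Ici 0) (x : A.domain) :
    0 ≤ (inner ℂ (x : H) (A x)).re := by
  have key : ∀ l : ℝ, 0 < l → 0 ≤ (inner ℂ (x : H) (A x)).re + l * ‖(x : H)‖ ^ 2 := by
    intro l hl
    obtain ⟨R, hR⟩ := exists_isResolventAt hσ hl
    have hsa := hR.isSelfAdjoint hA
    -- A negative `μ` in the spectrum of `R = (A + l)⁻¹` would come from the point `μ⁻¹ - l < 0` of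
    -- the spectrum of `A`. With `S = (A + l - μ⁻¹)⁻¹`, the inverse of `μ - R` is `μ⁻¹(1 + μ⁻¹S)`.
    have hpos : 0 ≤ R := by
      rw [StarOrderedRing.nonneg_iff_spectrum_nonneg (R := ℝ) R hsa]
      intro μ hμ
      by_contra hneg
      push Not at hneg
      have hinv : 0 < l - μ⁻¹ := by
        have := inv_lt_zero.2 hneg
        linarith
      obtain ⟨S, hS⟩ := exists_isResolventAt hσ hinv
      have e1 := hR.resolvent_identity hS
      have e2 := hS.resolvent_identity hR
      have hμ0 : (μ : ℂ) ≠ 0 := by exact_mod_cast hneg.ne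
      have hne := hneg.ne
      have c1 : ((l - μ⁻¹ - l : ℝ) : ℂ) = -(μ : ℂ)⁻¹ := by push_cast; ring
      have c2 : ((l - (l - μ⁻¹) : ℝ) : ℂ) = (μ : ℂ)⁻¹ := by push_cast; ring
      rw [c1] at e1
      rw [c2] at e2
      have f1 : R * S = (μ : ℂ) • (S - R) := by
        have : S - R = (μ : ℂ)⁻¹ • (R * S) := by
          rw [sub_eq_iff_eq_add]; nth_rw 2 [e1]; module
        rw [this, smul_smul, mul_inv_cancel₀ hμ0, one_smul]
      have f2 : S * R = (μ : ℂ) • (S - R) := by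
        have : S - R = (μ : ℂ)⁻¹ • (S * R) := by
          rw [sub_eq_iff_eq_add]; nth_rw 1 [e2]; module
        rw [this, smul_smul, mul_inv_cancel₀ hμ0, one_smul]
      have ha : algebraMap ℝ (H →L[ℂ] H) μ = (μ : ℂ) • (1 : H →L[ℂ] H) := by
        rw [Algebra.algebraMap_eq_smul_one]; rfl
      refine hμ ?_
      change IsUnit (algebraMap ℝ (H →L[ℂ] H) μ - R)
      rw [ha]
      refine ⟨⟨(μ : ℂ) • (1 : H →L[ℂ] H) - R, (μ : ℂ)⁻¹ • (1 + (μ : ℂ)⁻¹ • S), ?_, ?_⟩, rfl⟩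
      · simp only [sub_mul, mul_smul_comm, smul_mul_assoc, mul_add, mul_one, one_mul, f1]
        match_scalars <;> field_simp <;> ring
      · simp only [mul_sub, mul_smul_comm, smul_mul_assoc, add_mul, mul_one, one_mul, f2]
        match_scalars <;> field_simp <;> ring
    -- Positivity of `R` is tested on `(A + l)x`, which `R` sends back to `x`.
    have := ((ContinuousLinearMap.nonneg_iff_isPositive R).1 hpos).re_inner_nonneg_right
      (A x + (l : ℂ) • (x : H))
    rw [hR.2 x] at this
    rw [inner_add_left, inner_smul_left, Complex.conj_ofReal, hA x x] at this
    simpa [inner_self_eq_norm_sq_to_K, ← Complex.ofReal_pow] using this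
  by_contra hneg
  push Not at hneg
  rcases eq_or_ne (‖(x : H)‖ ^ 2) 0 with h0 | h0
  · have := key 1 one_pos
    rw [h0] at this
    linarith
  · have hp : 0 < ‖(x : H)‖ ^ 2 := lt_of_le_of_ne (by positivity) h0.symm
    -- This `l` compensates only half of the negative expectation, so the sum stays negative.
    have := key (-(inner ℂ (x : H) (A x)).re / (2 * ‖(x : H)‖ ^ 2))
      (div_pos (by linarith) (by positivity))
    have e : -(inner ℂ (x : H) (A x)).re / (2 * ‖(x : H)‖ ^ 2) * ‖(x : H)‖ ^ 2
        = -(inner ℂ (x : H) (A x)).re / 2 := by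
      rw [div_mul_eq_mul_div, mul_div_mul_right _ _ h0]
    rw [e] at this
    linarith

end Operators

end Galilean

namespace Galilean

/-! ### Commutation relations in the Bargmann group. -/

namespace BargmannGroup

/-- The pure Galilei boost by `v`. -/
def pureBoost (v : Space) : BargmannGroup := ⟨1, v, 0, 0, 0⟩

theorem translation_zero : translation 0 0 = 1 := rfl

theorem pureBoost_zero : pureBoost 0 = 1 := rfl

theorem translation_mul (a b : Space) (σ τ : ℝ) :
    translation a σ * translation b τ = translation (a + b) (σ + τ) := by
  simp only [translation, mul_def]
  ext1 <;> simp [rotate_one, add_comm]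

theorem central_mul_comm (θ : ℝ) (g : BargmannGroup) : central θ * g = g * central θ := by
  simp only [central, mul_def]
  ext1 <;> simp [rotate_one, add_comm]

/-- The cocycle is where mass enters: `τ = 0` leaves the central phase `v · a` used for the vacuum,
and `a = 0` leaves the kinetic term `|v|²τ/2` used for the boosted energy. -/
theorem pureBoost_mul_translation (v a : Space) (τ : ℝ) :
    pureBoost v * translation a τ = translation (a + τ • v) τ *
      (central (inner ℝ v a + inner ℝ v v / 2 * τ) * pureBoost v) := by
  simp only [central, pureBoost, translation, mul_def]
  ext1 <;> simp [rotate_one, add_comm]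

theorem continuous_translation : Continuous fun p : Space × ℝ => translation p.1 p.2 := by
  rw [continuous_induced_rng]
  change Continuous fun p : Space × ℝ => ((1 : SO3), (0 : Space), p.1, p.2, (0 : ℝ))
  fun_prop

theorem continuous_pureBoost : Continuous pureBoost := by
  rw [continuous_induced_rng]
  change Continuous fun v : Space => ((1 : SO3), v, (0 : Space), (0 : ℝ), (0 : ℝ))
  fun_prop

end BargmannGroup

open BargmannGroup

/-! ### Mass, boosts and positivity of the energy. -/

namespace GalileanNet

variable {H : Type*} [NormedAddCommGroup H] [InnerProductSpace ℂ H] [CompleteSpace H]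
variable (N : GalileanNet H)

theorem U_mul_apply (g h : BargmannGroup) (x : H) :
    (N.U (g * h) : H →L[ℂ] H) x = (N.U g : H →L[ℂ] H) ((N.U h : H →L[ℂ] H) x) := by
  simp

theorem U_one_apply (x : H) : (N.U 1 : H →L[ℂ] H) x = x := by
  simp

theorem inner_U_apply (g : BargmannGroup) (x y : H) :
    inner ℂ ((N.U g : H →L[ℂ] H) x) ((N.U g : H →L[ℂ] H) y) = inner ℂ x y :=
  Unitary.inner_map_map _ _ _

theorem continuous_translation_apply (x : H) {f : ℝ → Space × ℝ} (hf : Continuous f) :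
    Continuous fun s => (N.U (translation (f s).1 (f s).2) : H →L[ℂ] H) x :=
  (N.continuous_U x).comp (continuous_translation.comp hf)

/-- The vectors of mass `M`, as common eigenvectors of the central unitaries. -/
def HasMass (M : ℝ) (x : H) : Prop :=
  ∀ θ : ℝ, (N.U (central θ) : H →L[ℂ] H) x = Complex.exp (Complex.I * θ * M) • x

/-! ### The vacuum has mass zero -/

/-- Uniqueness gives `U(θ)Ω = cΩ`. Moving a translation by `a` past a boost by `v` with `v · a = θ`
gives `⟨Ω, U(v)Ω⟩ = c⟨Ω, U(v)Ω⟩`. By strong continuity this matrix element is nonzero for some small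
`v ≠ 0`, so `c = 1`. -/
theorem central_vacuum (hv : N.UniqueVacuum) (θ : ℝ) :
    (N.U (central θ) : H →L[ℂ] H) N.vacuum = N.vacuum := by
  have hinv : N.IsTranslationInvariant ((N.U (central θ) : H →L[ℂ] H) N.vacuum) := by
    intro a τ
    rw [← N.U_mul_apply, ← central_mul_comm, N.U_mul_apply, hv.1 a τ]
  obtain ⟨c, -, hc⟩ := hv.2 _ (by rw [Unitary.norm_map, N.norm_vacuum]) hinv
  have hcont : Continuous fun v : Space =>
      inner ℂ N.vacuum ((N.U (pureBoost v) : H →L[ℂ] H) N.vacuum) :=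
    continuous_const.inner ((N.continuous_U N.vacuum).comp continuous_pureBoost)
  have h0 : inner ℂ N.vacuum ((N.U (pureBoost 0) : H →L[ℂ] H) N.vacuum) ≠ 0 := by
    rw [pureBoost_zero, N.U_one_apply, inner_self_eq_norm_sq_to_K, N.norm_vacuum]
    simp
  have hev : ∀ᶠ v in 𝓝[≠] (0 : Space),
      inner ℂ N.vacuum ((N.U (pureBoost v) : H →L[ℂ] H) N.vacuum) ≠ 0 :=
    (hcont.tendsto 0).eventually_ne h0 |>.filter_mono nhdsWithin_le_nhds
  obtain ⟨v, hne, hv0⟩ := (hev.and self_mem_nhdsWithin).exists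
  have hvv : inner ℝ v v ≠ 0 := inner_self_ne_zero.2 hv0
  set a : Space := (θ / inner ℝ v v) • v with ha
  have hcomm : pureBoost v * translation a 0
      = translation a 0 * (pureBoost v * central θ) := by
    rw [pureBoost_mul_translation, ← central_mul_comm, ha, inner_smul_right,
      div_mul_cancel₀ _ hvv]
    simp
  have e : inner ℂ N.vacuum ((N.U (pureBoost v) : H →L[ℂ] H) N.vacuum)
      = c * inner ℂ N.vacuum ((N.U (pureBoost v) : H →L[ℂ] H) N.vacuum) := by
    conv_lhs =>
      arg 3
      rw [← hv.1 a 0]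
    rw [← N.U_mul_apply, hcomm, N.U_mul_apply, N.U_mul_apply, hc]
    conv_lhs => rw [← hv.1 a 0]
    rw [N.inner_U_apply, hv.1 a 0, map_smul, inner_smul_right]
  have hc1 : c = 1 := by
    have := mul_right_cancel₀ hne ((one_mul _).trans e)
    exact this.symm
  rw [hc, hc1, one_smul]

/-! ### The Hamiltonian -/

theorem hamiltonian_apply_of_hasDerivAt {x d : H}
    (h : HasDerivAt (fun τ => (N.U (translation 0 τ) : H →L[ℂ] H) x) d 0) :
    ∃ hx : x ∈ N.hamiltonian.domain, N.hamiltonian ⟨x, hx⟩ = (-Complex.I) • d := by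
  refine ⟨h.differentiableAt, ?_⟩
  change (-Complex.I) • deriv (fun τ => (N.U (translation 0 τ) : H →L[ℂ] H) x) 0 = _
  rw [h.deriv]

theorem hasDerivAt_of_mem_hamiltonian (x : N.hamiltonian.domain) :
    HasDerivAt (fun τ => (N.U (translation 0 τ) : H →L[ℂ] H) (x : H))
      (Complex.I • N.hamiltonian x) 0 := by
  have h : DifferentiableAt ℝ (fun τ => (N.U (translation 0 τ) : H →L[ℂ] H) (x : H)) 0 := x.2
  convert h.hasDerivAt using 1
  change Complex.I • ((-Complex.I) • deriv (fun τ => (N.U (translation 0 τ) : H →L[ℂ] H) x) 0) = _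
  rw [smul_smul]
  simp

/-- Differentiate the constant function `⟨U(τ)x, U(τ)y⟩` at `τ = 0`. -/
theorem hamiltonian_symmetric (x y : N.hamiltonian.domain) :
    inner ℂ (N.hamiltonian x) (y : H) = inner ℂ (x : H) (N.hamiltonian y) := by
  have h := (N.hasDerivAt_of_mem_hamiltonian x).inner ℂ (N.hasDerivAt_of_mem_hamiltonian y)
  have h2 : HasDerivAt (fun _ : ℝ => inner ℂ (x : H) (y : H)) 0 0 := hasDerivAt_const _ _
  simp only [N.inner_U_apply] at h
  have := h.unique h2
  simp only [translation_zero, N.U_one_apply, inner_smul_left, inner_smul_right,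
    Complex.conj_I] at this
  have h3 : Complex.I * (inner ℂ (x : H) (N.hamiltonian y) - inner ℂ (N.hamiltonian x) (y : H))
      = 0 := by rw [← this]; ring
  rcases mul_eq_zero.1 h3 with h4 | h4
  · exact absurd h4 Complex.I_ne_zero
  · exact (sub_eq_zero.1 h4).symm

theorem hamiltonian_commute {g : BargmannGroup}
    (hg : ∀ τ, translation 0 τ * g = g * translation 0 τ) (x : N.hamiltonian.domain) :
    ∃ h : (N.U g : H →L[ℂ] H) x ∈ N.hamiltonian.domain,
      N.hamiltonian ⟨(N.U g : H →L[ℂ] H) x, h⟩ = (N.U g : H →L[ℂ] H) (N.hamiltonian x) := by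
  have h := ((N.U g : H →L[ℂ] H).restrictScalars ℝ).hasFDerivAt.comp_hasDerivAt (0 : ℝ)
    (N.hasDerivAt_of_mem_hamiltonian x)
  have h' : HasDerivAt
      (fun τ => (N.U (translation 0 τ) : H →L[ℂ] H) ((N.U g : H →L[ℂ] H) (x : H)))
      ((N.U g : H →L[ℂ] H) (Complex.I • N.hamiltonian x)) 0 := by
    refine HasDerivAt.congr_of_eventuallyEq h (Eventually.of_forall fun τ => ?_)
    beta_reduce
    rw [← N.U_mul_apply, hg, N.U_mul_apply]
    rfl
  obtain ⟨hx, e⟩ := N.hamiltonian_apply_of_hasDerivAt h'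
  refine ⟨hx, ?_⟩
  rw [e, map_smul, smul_smul]
  simp

/-- In a net of positive energy, a vector of mass `M` which is smooth for time translations and
for space translations along `v` satisfies the boosted form of positivity of the energy. -/
theorem boosted_energy_nonneg (hE : N.PositiveEnergy) {M : ℝ} {z d q : H} (hz : N.HasMass M z)
    {e : Space} (hd : HasDerivAt (fun τ => (N.U (translation 0 τ) : H →L[ℂ] H) z) d 0)
    (hq : HasDerivAt (fun s : ℝ => (N.U (translation (s • e) 0) : H →L[ℂ] H) z) q 0) (s : ℝ) :
    0 ≤ (inner ℂ z ((-Complex.I) • d)).re + s * (inner ℂ z ((-Complex.I) • q)).re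
      + inner ℝ e e / 2 * M * s ^ 2 * ‖z‖ ^ 2 := by
  set b := pureBoost (s • e)
  set c : ℝ := inner ℝ e e / 2 * s ^ 2 with hc
  have h1 : HasDerivAt (fun τ : ℝ => (N.U (translation (τ • s • e) 0) : H →L[ℂ] H) z)
      (s • q) 0 := by
    have hs : HasDerivAt (fun τ : ℝ => τ * s) s 0 := by
      simpa using (hasDerivAt_id (0 : ℝ)).mul_const s
    have hq' : HasDerivAt (fun s : ℝ => (N.U (translation (s • e) 0) : H →L[ℂ] H) z) q
      ((fun τ : ℝ => τ * s) 0) := by simpa using hq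
    have := HasDerivAt.scomp (0 : ℝ) hq' hs
    simpa [Function.comp_def, mul_smul] using this
  have hph : HasDerivAt (fun τ : ℝ => Complex.exp (Complex.I * ((c * τ : ℝ) : ℂ) * M))
      (Complex.I * c * M) 0 := by
    have hl : HasDerivAt (fun τ : ℝ => Complex.I * ((c * τ : ℝ) : ℂ) * M)
        (Complex.I * c * M) 0 := by
      have := (((hasDerivAt_id (0 : ℝ)).const_mul c).ofReal_comp.const_mul Complex.I).mul_const
        (M : ℂ)
      simpa using this
    simpa using hl.cexp
  have h2 : HasDerivAt (fun τ : ℝ => Complex.exp (Complex.I * ((c * τ : ℝ) : ℂ) * M) •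
      (N.U (translation (τ • s • e) 0) : H →L[ℂ] H) z) (s • q + (Complex.I * c * M) • z) 0 := by
    have := hph.fun_smul h1
    simpa [translation_zero] using this
  have h3 := hasDerivAt_apply_of_contraction (u := fun τ => (N.U (translation 0 τ) : H →L[ℂ] H))
    (fun t x => (Unitary.norm_map _ _).le)
    (fun x => N.continuous_translation_apply x (f := fun τ => (0, τ)) (by fun_prop)) h2
    (d := d) (by simpa [translation_zero] using hd)
  have h4 := ((N.U b⁻¹ : H →L[ℂ] H).restrictScalars ℝ).hasFDerivAt.comp_hasDerivAt (0 : ℝ) h3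
  -- Time evolution of the boosted vector `U(b⁻¹)z` is pulled back through `b⁻¹`. It becomes time
  -- evolution of `z` times a space translation by `τ s e` and a central phase, hence the extra
  -- terms in the derivative.
  have h5 : HasDerivAt
      (fun τ => (N.U (translation 0 τ) : H →L[ℂ] H) ((N.U b⁻¹ : H →L[ℂ] H) z))
      ((N.U b⁻¹ : H →L[ℂ] H) (d + (s • q + (Complex.I * c * M) • z))) 0 := by
    convert h4 using 1
    · funext τ
      have hcomm : translation 0 τ * b⁻¹ = b⁻¹ * (translation 0 τ *
          (translation (τ • s • e) 0 * central (c * τ))) := by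
        rw [mul_inv_eq_iff_eq_mul]
        rw [mul_assoc, eq_inv_mul_iff_mul_eq, pureBoost_mul_translation]
        rw [← mul_assoc (translation 0 τ) (translation _ _), translation_mul]
        simp only [inner_smul_left, inner_smul_right, hc, inner_zero_right, mul_assoc]
        congr 2
        · simp
        · congr 2
          simp
          ring
      rw [← N.U_mul_apply, hcomm]
      simp only [N.U_mul_apply, hz (c * τ), map_smul, Function.comp_apply,
        ContinuousLinearMap.coe_restrictScalars']
    · simp [translation_zero]
  obtain ⟨hx, ex⟩ := N.hamiltonian_apply_of_hasDerivAt h5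
  have := re_inner_nonneg_of_unboundedSpectrum N.hamiltonian_symmetric hE ⟨_, hx⟩
  rw [ex, ← map_smul] at this
  simp only [N.inner_U_apply] at this
  convert this using 1
  have e1 : (-Complex.I) • (d + (s • q + (Complex.I * c * M) • z))
      = (-Complex.I) • d + ((s : ℂ) • ((-Complex.I) • q) + ((c * M : ℝ) : ℂ) • z) := by
    have : ((c * M : ℝ) : ℂ) = -Complex.I * (Complex.I * c * M) := by
      push_cast; linear_combination ((c : ℂ) * M) * Complex.I_sq
    rw [this, ← Complex.coe_smul]
    module
  rw [e1]
  simp only [inner_add_right, inner_smul_right _ _ (s : ℂ), inner_smul_right _ _ ((c * M : ℝ) : ℂ),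
    inner_self_eq_norm_sq_to_K (𝕜 := ℂ), Complex.add_re]
  rw [Complex.re_ofReal_mul, Complex.re_ofReal_mul]
  simp only [Complex.coe_algebraMap, ← Complex.ofReal_pow, Complex.ofReal_re, hc]
  ring

/-- In a net of positive energy there are no vectors of negative mass. -/
theorem eq_zero_of_hasMass_neg (hE : N.PositiveEnergy) {M : ℝ} (hM : M < 0) {y : H}
    (hy : N.HasMass M y) : y = 0 := by
  by_contra hy0
  obtain ⟨e, he⟩ := exists_ne (0 : Space)
  obtain ⟨R, hR⟩ := exists_isResolventAt hE one_pos
  let p : ℝ → H := fun s => (N.U (translation (s • e) 0) : H →L[ℂ] H) y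
  have hp : Continuous p :=
    N.continuous_translation_apply y (f := fun s => (s • e, 0)) (by fun_prop)
  have hR' : ∀ {g : BargmannGroup}, (∀ τ, translation 0 τ * g = g * translation 0 τ) →
      ∀ x, R ((N.U g : H →L[ℂ] H) x) = (N.U g : H →L[ℂ] H) (R x) := fun hg =>
    hR.commute (N.hamiltonian_commute hg)
  -- Averaging over translations along `e` yields vectors differentiable in that direction. They
  -- cannot all vanish, since their derivative in `h` at 0 is `y`.
  obtain ⟨h, hh⟩ : ∃ h : ℝ, ∫ s in (0 : ℝ)..h, p s ≠ 0 := by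
    by_contra! hall
    have h1 : HasDerivAt (fun h => ∫ s in (0 : ℝ)..h, p s) (p 0) 0 :=
      intervalIntegral.integral_hasDerivAt_right (hp.intervalIntegrable _ _)
        hp.aestronglyMeasurable.stronglyMeasurableAtFilter hp.continuousAt
    simp only [hall] at h1
    have := h1.unique (hasDerivAt_const _ _)
    simp only [p, zero_smul, translation_zero, N.U_one_apply] at this
    exact hy0 this
  set w := ∫ s in (0 : ℝ)..h, p s with hw
  -- The resolvent puts the average into the domain of the Hamiltonian. It commutes with space
  -- translations and the centre, so smoothness and mass survive, and its injectivity keeps the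
  -- vector nonzero.
  set z := R w with hz
  have hz0 : z ≠ 0 := fun h0 => hh (hR.injective h0)
  have hwd : HasDerivAt (fun s : ℝ => (N.U (translation (s • e) 0) : H →L[ℂ] H) w)
      (p h - p 0) 0 := by
    have hF : ∀ t : ℝ, HasDerivAt (fun h => ∫ s in (0 : ℝ)..h, p s) (p t) t := fun t =>
      intervalIntegral.integral_hasDerivAt_right (hp.intervalIntegrable _ _)
        hp.aestronglyMeasurable.stronglyMeasurableAtFilter hp.continuousAt
    have e1 : (fun s : ℝ => (N.U (translation (s • e) 0) : H →L[ℂ] H) w)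
        = fun s => (∫ r in (0 : ℝ)..(s + h), p r) - ∫ r in (0 : ℝ)..s, p r := by
      funext s
      rw [intervalIntegral.integral_interval_sub_left (hp.intervalIntegrable _ _)
        (hp.intervalIntegrable _ _), hw,
        ← ContinuousLinearMap.intervalIntegral_comp_comm _ (hp.intervalIntegrable _ _)]
      have : ∀ r, (N.U (translation (s • e) 0) : H →L[ℂ] H) (p r) = p (s + r) := by
        intro r
        simp only [p]
        rw [← N.U_mul_apply, translation_mul, add_smul, add_zero]
      simp only [this]
      rw [intervalIntegral.integral_comp_add_left (fun r => p r) s]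
      simp
    rw [e1]
    have h1 : HasDerivAt (fun s : ℝ => ∫ r in (0 : ℝ)..(s + h), p r) (p h) 0 :=
      HasDerivAt.comp_add_const (f := fun t => ∫ r in (0 : ℝ)..t, p r) (0 : ℝ) h
        (by simpa using hF h)
    exact h1.fun_sub (hF 0)
  have hzq : HasDerivAt (fun s : ℝ => (N.U (translation (s • e) 0) : H →L[ℂ] H) z)
      (R (p h - p 0)) 0 := by
    have := (R.restrictScalars ℝ).hasFDerivAt.comp_hasDerivAt (0 : ℝ) hwd
    refine HasDerivAt.congr_of_eventuallyEq this (Eventually.of_forall fun s => ?_)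
    simp only [Function.comp_apply, hz]
    refine (hR' (fun τ => ?_) w).symm
    rw [translation_mul, translation_mul, add_comm, add_comm τ]
  obtain ⟨hzdom, -⟩ := hR.1 w
  have hzd := N.hasDerivAt_of_mem_hamiltonian ⟨z, hzdom⟩
  have hzM : N.HasMass M z := by
    intro θ
    rw [hz, ← hR' (fun τ => (central_mul_comm θ _).symm), ← map_smul, hw,
      ← ContinuousLinearMap.intervalIntegral_comp_comm _ (hp.intervalIntegrable _ _),
      ← intervalIntegral.integral_smul]
    congr 2
    funext s
    simp only [p]
    rw [← N.U_mul_apply, central_mul_comm, N.U_mul_apply, hy θ, map_smul]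
  have key := N.boosted_energy_nonneg hE hzM hzd hzq
  have hee : 0 < inner ℝ e e := real_inner_self_pos.2 he
  set c := -(inner ℝ e e / 2 * M * ‖z‖ ^ 2) with hcdef
  have hcpos : 0 < c := by
    have : 0 < ‖z‖ ^ 2 := by positivity
    rw [hcdef, neg_pos]
    exact mul_neg_of_neg_of_pos (mul_neg_of_pos_of_neg (by positivity) hM) this
  -- Adding the inequalities for `s` and `-s` cancels the momentum term.
  have key2 : ∀ s : ℝ, c * s ^ 2 ≤ (inner ℂ z ((-Complex.I) • Complex.I •
      N.hamiltonian ⟨z, hzdom⟩)).re := by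
    intro s
    have k1 := key s
    have k2 := key (-s)
    rw [hcdef]
    nlinarith
  set a := (inner ℂ z ((-Complex.I) • Complex.I • N.hamiltonian ⟨z, hzdom⟩)).re
  have k := key2 (|a| / c + 1)
  have ha := le_abs_self a
  have ha0 := abs_nonneg a
  have : c * (|a| / c + 1) ^ 2 = |a| ^ 2 / c + 2 * |a| + c := by field_simp; ring
  have h6 : 0 ≤ |a| ^ 2 / c := by positivity
  linarith

end GalileanNet

end Galilean

namespace Galilean

open BargmannGroup

/-! ### Affiliated operators and separating vectors. -/

section Operators

variable {H : Type*} [NormedAddCommGroup H] [InnerProductSpace ℂ H] [CompleteSpace H]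

/-- An operator affiliated to a von Neumann algebra and annihilating a separating vector is zero. -/
theorem IsAffiliated.apply_eq_zero {A : H →ₗ.[ℂ] H} {M : VonNeumannAlgebra H}
    (hA : IsAffiliated A M) {Ω : H} (hΩ : ∀ B ∈ M, B Ω = 0 → B = 0) (h0 : (Ω, (0 : H)) ∈ A.graph)
    {x y : H} (hxy : (x, y) ∈ A.graph) : y = 0 := by
  let K : Submodule ℂ H := A.graph.comap (LinearMap.inl ℂ H H)
  have hK : ∀ x, x ∈ K ↔ (x, (0 : H)) ∈ A.graph := fun x => Iff.rfl
  have hKc : IsClosed (K : Set H) :=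
    IsClosed.preimage (f := fun x : H => (x, (0 : H))) (by fun_prop) hA.2.1
  have : CompleteSpace K := hKc.completeSpace_coe
  -- `K` is the kernel of `A`, closed because the graph is. Affiliation makes it invariant under the
  -- commutant, so its projection lies in `M`.
  have hP : K.starProjection ∈ M := by
    rw [VonNeumannAlgebra.IsStarProjection.mem_iff isStarProjection_starProjection]
    intro T hT z hz
    rw [Submodule.range_starProjection] at hz ⊢
    have := hA.2.2 T hT z 0 ((hK z).1 hz)
    rw [map_zero] at this
    exact this
  have hP1 : 1 - K.starProjection = 0 := by
    refine hΩ _ (sub_mem (one_mem _) hP) ?_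
    simp [Submodule.starProjection_eq_self_iff.2 ((hK Ω).2 h0)]
  have hx : x ∈ K := by
    rw [← Submodule.starProjection_eq_self_iff, ← sub_eq_zero.1 hP1]
    rfl
  exact A.mem_graph_snd_inj hxy ((hK x).1 hx) rfl

end Operators

/-! ### Test functions -/

instance : Nonempty DeltaFamily := by
  let b : ∀ ε : ℝ, 0 < ε → ContDiffBump (0 : ℝ) := fun ε h =>
    ⟨ε / 2, ε, by linarith, by linarith⟩
  let φ : ∀ ε : ℝ, 0 < ε → TimeTest := fun ε h =>
    { toFun := (b ε h).normed volume
      contDiff' := (b ε h).contDiff_normed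
      hasCompactSupport' := (b ε h).hasCompactSupport_normed
      tsupport_subset' := fun _ _ => trivial }
  -- The value for `ε ≤ 0` is immaterial: every condition concerns `ε > 0`.
  refine ⟨⟨fun ε => if h : 0 < ε then φ ε h else 0, ?_, ?_, ?_⟩⟩
  · intro ε h t
    simp only [h, dif_pos]
    exact (b ε h).nonneg_normed t
  · intro ε h
    simp only [h, dif_pos]
    exact (b ε h).integral_normed
  · intro V hV
    obtain ⟨r, hr, hrV⟩ := Metric.mem_nhds_iff.1 hV
    filter_upwards [Ioo_mem_nhdsGT hr] with ε hε
    simp only [hε.1, dif_pos]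
    refine Set.Subset.trans ?_ hrV
    change tsupport ((b ε hε.1).normed volume) ⊆ _
    rw [ContDiffBump.tsupport_normed_eq]
    exact Metric.closedBall_subset_ball hε.2

theorem exists_spaceTest_integral_ne_zero : ∃ g : SpaceTest, ∫ x, conj (g x) * g x ≠ 0 := by
  let b : ContDiffBump (0 : Space) := default
  let g : SpaceTest :=
    { toFun := fun x => (b x : ℂ)
      contDiff' := Complex.ofRealCLM.contDiff.comp b.contDiff
      hasCompactSupport' := b.hasCompactSupport.comp_left Complex.ofReal_zero
      tsupport_subset' := fun _ _ => trivial }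
  refine ⟨g, ?_⟩
  have e : ∀ x, conj (g x) * g x = ((b x * b x : ℝ) : ℂ) := by
    intro x
    change conj (b x : ℂ) * (b x : ℂ) = _
    rw [Complex.conj_ofReal, Complex.ofReal_mul]
  simp only [e]
  rw [integral_complex_ofReal, Complex.ofReal_ne_zero]
  have hc : Continuous fun x => b x * b x := b.continuous.mul b.continuous
  refine (hc.integral_pos_of_hasCompactSupport_nonneg_nonzero (x := 0)
    (b.hasCompactSupport.mul_right) (fun x => mul_self_nonneg _) ?_).ne'
  have : b 0 = 1 := b.one_of_mem_closedBall (Metric.mem_closedBall_self b.rIn_pos.le)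
  simp [this]

/-- The support of a test function lies in an admissible region of the Reeh–Schlieder property. -/
theorem exists_region_tsupport_subset (f : SpacetimeTest) :
    ∃ O, IsRegion O ∧ (interior O).Nonempty ∧ (interior Oᶜ).Nonempty ∧ tsupport f ⊆ O := by
  obtain ⟨r, hr, hf⟩ := f.hasCompactSupport.isCompact.isBounded.subset_ball_lt 0 (0 : Spacetime)
  refine ⟨Metric.ball 0 r, ⟨Metric.isOpen_ball, Metric.isBounded_ball⟩, ?_, ?_, hf⟩
  · rw [Metric.isOpen_ball.interior_eq]
    exact ⟨0, Metric.mem_ball_self hr⟩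
  · refine ⟨((0 : Space), r + 1), ?_⟩
    rw [mem_interior]
    refine ⟨(Metric.closedBall 0 r)ᶜ, Set.compl_subset_compl.2 Metric.ball_subset_closedBall,
      Metric.isClosed_closedBall.isOpen_compl, ?_⟩
    rw [Set.mem_compl_iff, mem_closedBall_zero_iff, Prod.norm_mk, not_le]
    exact lt_max_of_lt_right (by rw [Real.norm_of_nonneg (by linarith)]; linarith)

/-! ### Vanishing of the annihilation fields and the contradiction. -/

namespace GalileanNet

variable {H : Type*} [NormedAddCommGroup H] [InnerProductSpace ℂ H] [CompleteSpace H]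
variable (N : GalileanNet H)

/-- A field of mass charge `-m₀` applied to a vector of mass zero has mass `-m₀`. -/
theorem hasMass_psi_apply {m₀ : ℝ} (hm : N.HasMassCharge m₀) {f : SpacetimeTest} {x y : H}
    (hx : ∀ θ, (N.U (central θ) : H →L[ℂ] H) x = x) (hxy : (x, y) ∈ (N.psi f).graph) :
    N.HasMass (-m₀) y := by
  intro θ
  have h := (hm θ f).1
  obtain ⟨⟨x', hx'⟩, rfl, rfl⟩ := (LinearPMap.mem_graph_iff _).1 hxy
  have hstar : star (N.U (central θ) : H →L[ℂ] H) x' = x' := by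
    have h1 : (N.U (central θ) : H →L[ℂ] H) x' = x' := hx θ
    conv_lhs => rw [← h1]
    exact congrArg (fun V : H →L[ℂ] H => V x') (Unitary.coe_star_mul_self (N.U (central θ)))
  have hmem : x' ∈ (conjugate (N.U (central θ)) (N.psi f)).domain := by
    change star (N.U (central θ) : H →L[ℂ] H) x' ∈ (N.psi f).domain
    rw [hstar]
    exact hx'
  have e1 : conjugate (N.U (central θ)) (N.psi f) ⟨x', hmem⟩
      = (N.U (central θ) : H →L[ℂ] H) (N.psi f ⟨x', hx'⟩) := by
    change (N.U (central θ) : H →L[ℂ] H) (N.psi f ⟨star (N.U (central θ) : H →L[ℂ] H) x', _⟩) = _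
    congr 2
    exact Subtype.ext hstar
  have e2 : conjugate (N.U (central θ)) (N.psi f) ⟨x', hmem⟩
      = (Complex.exp (-(Complex.I * θ * m₀)) • N.psi f) ⟨x', hx'⟩ := by
    have h2 := (LinearPMap.ext_iff.1 h).2
    exact @h2 x' hmem hx'
  rw [← e1, e2, LinearPMap.smul_apply]
  congr 2
  push_cast
  ring

variable {N}

theorem psi_vacuum_eq_zero (hN : N.AxiomsExceptLocality) {m₀ : ℝ} (hm₀ : 0 < m₀)
    (hm : N.HasMassCharge m₀) {f : SpacetimeTest} {y : H}
    (hy : (N.vacuum, y) ∈ (N.psi f).graph) : y = 0 :=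
  N.eq_zero_of_hasMass_neg hN.positive_energy (neg_lt_zero.2 hm₀)
    (N.hasMass_psi_apply hm (N.central_vacuum hN.unique_vacuum) hy)

/-- Each approximant `ψ(χ_ε ⊗ g)` with `ε` small kills `Ω`, hence every vector of its domain. The
region may depend on `ε`, since only the limit of zeros is taken. -/
theorem field₀_psi_eq_zero (hN : N.AxiomsExceptLocality) {m₀ : ℝ} (hm₀ : 0 < m₀)
    (hm : N.HasMassCharge m₀) (hRS : N.ReehSchlieder) (T : N.TimeZeroFields)
    (hT : N.vacuum ∈ T.domain) (g : SpaceTest) : T.field₀ .psi g = 0 := by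
  obtain ⟨χ⟩ := (inferInstance : Nonempty DeltaFamily)
  ext x
  obtain ⟨z, hz, hlim⟩ := T.tendsto_field₀ .psi g χ x
  obtain ⟨w, hw, -⟩ := T.tendsto_field₀ .psi g χ ⟨N.vacuum, hT⟩
  have hz0 : ∀ᶠ ε in 𝓝[>] (0 : ℝ), z ε = 0 := by
    filter_upwards [hz, hw] with ε hzε hwε
    obtain ⟨O, hO, hO1, hO2, hfO⟩ := exists_region_tsupport_subset (tensor (χ.fn ε) g)
    have haff := (hN.generated O hO).1 .psi _ hfO
    have h0 := psi_vacuum_eq_zero hN hm₀ hm hwε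
    rw [h0] at hwε
    exact haff.apply_eq_zero (hRS O hO hO1 hO2).2 hwε hzε
  exact tendsto_nhds_unique hlim (tendsto_const_nhds.congr' (hz0.mono fun _ h => h.symm))

/-- With `ψ₀(g) = 0` the commutator `[ψ₀(g), ψ₀†(g)]` is zero, while on `Ω` it must act as the
nonzero scalar `∫|g|²`. -/
theorem not_reehSchlieder (hN : N.AxiomsExceptLocality) {m₀ : ℝ} (hm₀ : 0 < m₀)
    (hm : N.HasMassCharge m₀) (hT : N.TimeZeroFieldsExist) : ¬ N.ReehSchlieder := by
  intro hRS
  obtain ⟨T, hT, -⟩ := hT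
  obtain ⟨g, hg⟩ := exists_spaceTest_integral_ne_zero
  have h := (hN.ccr T g g).1
  rw [field₀_psi_eq_zero hN hm₀ hm hRS T hT g, zero_mul, mul_zero, sub_zero] at h
  have h1 := congrArg Subtype.val (LinearMap.congr_fun h ⟨N.vacuum, hT⟩)
  have h2 : (∫ x, conj (g x) * g x) • N.vacuum = 0 := h1.symm
  rcases smul_eq_zero.1 h2 with h3 | h3
  · exact hg h3
  · have := N.norm_vacuum
    rw [h3, norm_zero] at this
    exact zero_ne_one this

end GalileanNet

end Galilean

/-- A Galilean Haag–Kastler net whose canonical fields carry definite mass charge `∓ m₀`, `m₀ > 0`,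
and admit time-zero fields does not have the Reeh–Schlieder property; the same holds for nets that
are not required to satisfy equal-time locality. -/
theorem theorem2 {H : Type*} [NormedAddCommGroup H] [InnerProductSpace ℂ H] [CompleteSpace H]
    (N : Galilean.GalileanNet H) :
    (N.IsHaagKastler → (∃ m₀ : ℝ, 0 < m₀ ∧ N.HasMassCharge m₀) → N.TimeZeroFieldsExist →
      ¬ N.ReehSchlieder) ∧
    (N.AxiomsExceptLocality → (∃ m₀ : ℝ, 0 < m₀ ∧ N.HasMassCharge m₀) → N.TimeZeroFieldsExist →
      ¬ N.ReehSchlieder) :=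
  ⟨fun hN ⟨_, hm₀, hm⟩ hT =>
      Galilean.GalileanNet.not_reehSchlieder hN.toAxiomsExceptLocality hm₀ hm hT,
    fun hN ⟨_, hm₀, hm⟩ hT => Galilean.GalileanNet.not_reehSchlieder hN hm₀ hm hT⟩
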